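/- Let $K$ be a field and let $R=K[x_1,\dots,x_n]$ carry the standard $\mathbb Z$-grading. A Hilbert decomposition of a finitely generated graded $R$-module $M$ is a finite family $\mathscr H=(S_i,s_i)_i$, where each $S_i$ is a graded $K$-algebra retract of $R$ and $s_i\in\mathbb Z$, such that $M\cong\bigoplus_i S_i(-s_i)$ as graded $K$-vector spaces. Put $\operatorname{Hdepth}\mathscr H=\min_i\operatorname{depth}S_i(-s_i)$ and let $\operatorname{Hdepth}M$ be the maximum of $\operatorname{Hdepth}\mathscr H$ over all Hilbert decompositions $\mathscr H$ of $M$. Theorem 1.4. Let $1\le d\le n$. Let $I_{n,d}\subset R$ be the squarefree Veronese ideal, generated by all squarefree monomials of degree $d$ in $x_1,\dots,x_n$. Let $\hat{\mathfrak m}=(x_1,\dots,x_{n-d+1})$ be the irrelevant maximal ideal of $\hat R=K[x_1,\dots,x_{n-d+1}]$, and let $\hat{\mathfrak m}^d$ be its $d$-th power, that is, the ideal of $\hat R$ generated by all monomials of degree $d$. Then the maxima defining $\operatorname{Hdepth}(\hat{\mathfrak m}^d)$ (over $\hat R$) and $\operatorname{Hdepth}(I_{n,d})$ (over $R$) exist,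 and $$\operatorname{Hdepth}(\hat{\mathfrak m}^d)+d-1=\operatorname{Hdepth}(I_{n,d}).$$ -/

import Mathlib

open MvPolynomial

noncomputable section

namespace HilbertDepth

/-- The degree `k` component, `k ∈ ℤ`, of the standard graded polynomial ring
`R = K[x_1, …, x_n]`; it is zero for negative `k`. -/
def polyPart (K : Type*) [Field K] (n : ℕ) : ℤ → Submodule K (MvPolynomial (Fin n) K)
  | Int.ofNat m => homogeneousSubmodule (Fin n) K m
  | Int.negSucc _ => ⊥

/-- The standard grading of an ideal `I` of `R = K[x_1, …, x_n]`: the component `I_k` consists of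
the elements of `I` that are homogeneous of degree `k`. -/
def idealPart {K : Type*} [Field K] {n : ℕ} (I : Ideal (MvPolynomial (Fin n) K)) (k : ℤ) :
    Submodule K I :=
  (polyPart K n k).comap (I.subtype.restrictScalars K)

/-- The depth of an `A`-module `M` with respect to an ideal `J`: the supremum of the lengths of the
`M`-regular sequences contained in `J` (for `M ≠ 0`). -/
def depth {A : Type*} [CommRing A] (J : Ideal A) (M : Type*) [AddCommGroup M] [Module A M] : ℕ∞ :=
  ⨆ (rs : List A) (_ : (∀ r ∈ rs, r ∈ J) ∧ RingTheory.Sequence.IsRegular M rs), (rs.length : ℕ∞)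

/-- A graded `K`-algebra retract of `R = K[x_1, …, x_n]`. Graded `K`-algebra homomorphisms
`ι : S → R` and `π : R → S` with `π ∘ ι = id` identify `S`, via `ι`, with the image of the
idempotent graded endomorphism `ι ∘ π` of `R`, and every such idempotent arises in this way; the
retract is recorded through this idempotent. -/
structure GradedRetract (K : Type*) [Field K] (n : ℕ) where
  proj : MvPolynomial (Fin n) K →ₐ[K] MvPolynomial (Fin n) K
  proj_mem : ∀ (m : ℕ) (f : MvPolynomial (Fin n) K),
    f ∈ homogeneousSubmodule (Fin n) K m → proj f ∈ homogeneousSubmodule (Fin n) K m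
  proj_proj : ∀ f : MvPolynomial (Fin n) K, proj (proj f) = proj f

namespace GradedRetract

variable {K : Type*} [Field K] {n : ℕ}

/-- The retract itself, as a (graded) subalgebra of `R`. -/
def algebra (S : GradedRetract K n) : Subalgebra K (MvPolynomial (Fin n) K) :=
  S.proj.range

/-- The degree `k` component of the shifted module `S(-s)`, that is, `S(-s)_k = S_{k - s}`. -/
def shiftedPart (S : GradedRetract K n) (s k : ℤ) : Submodule K S.algebra :=
  (polyPart K n (k - s)).comap S.algebra.val.toLinearMap

/-- The irrelevant maximal ideal of `S`: the elements of `S` without constant term. -/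
def irrelevant (S : GradedRetract K n) : Ideal S.algebra :=
  (idealOfVars (Fin n) K).comap S.algebra.val

/-- The depth of `S`, which is also the depth of every shift `S(-s)`. -/
def depth (S : GradedRetract K n) : ℕ∞ :=
  HilbertDepth.depth S.irrelevant S.algebra

end GradedRetract

/-- A Hilbert decomposition of a graded module `M = ⨁_{k ∈ ℤ} M_k` over the standard graded ring
`R = K[x_1, …, x_n]`: a finite family `(S_i, s_i)` of graded `K`-algebra retracts `S_i` of `R` and
integers `s_i`, together with an isomorphism `M ≅ ⨁_i S_i(-s_i)` of graded `K`-vector spaces.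
(Only the graded vector space structure of `M` enters; the direct sum is finite and hence is
written as a product.) -/
structure HilbertDecomposition {K : Type*} [Field K] (n : ℕ) {M : Type*} [AddCommGroup M]
    [Module K M] (ℳ : ℤ → Submodule K M) where
  size : ℕ
  retract : Fin size → GradedRetract K n
  shift : Fin size → ℤ
  iso : M ≃ₗ[K] ((i : Fin size) → (retract i).algebra)
  map_iso : ∀ k : ℤ, (ℳ k).map iso.toLinearMap =
    Submodule.pi Set.univ (fun i => (retract i).shiftedPart (shift i) k)

/-- The Hilbert depth of a Hilbert decomposition: `min_i depth S_i(-s_i)`. -/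
def HilbertDecomposition.hdepth {K : Type*} [Field K] {n : ℕ} {M : Type*} [AddCommGroup M]
    [Module K M] {ℳ : ℤ → Submodule K M} (H : HilbertDecomposition n ℳ) : ℕ∞ :=
  ⨅ i, (H.retract i).depth

/-- The set of the Hilbert depths of all Hilbert decompositions of a graded module. -/
def hdepthSet {K : Type*} [Field K] (n : ℕ) {M : Type*} [AddCommGroup M]
    [Module K M] (ℳ : ℤ → Submodule K M) : Set ℕ∞ :=
  Set.range (fun H : HilbertDecomposition n ℳ => H.hdepth)

/-- The (standard graded) Hilbert depth of an ideal `I` of `K[x_1, …, x_n]`, as a graded module: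
the largest Hilbert depth of a Hilbert decomposition of `I`. -/
def hdepth {K : Type*} [Field K] {n : ℕ} (I : Ideal (MvPolynomial (Fin n) K)) : ℕ∞ :=
  sSup (hdepthSet n (idealPart I))

/-- The squarefree Veronese ideal `I_{n,d}`, generated by all squarefree monomials of degree `d`
in `K[x_1, …, x_n]`. -/
def squarefreeVeronese (K : Type*) [Field K] (n d : ℕ) : Ideal (MvPolynomial (Fin n) K) :=
  Ideal.span {f | ∃ s : Finset (Fin n), s.card = d ∧ f = ∏ i ∈ s, X i}

end HilbertDepth

end

open MvPolynomial

noncomputable section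

namespace HilbertDepth

/-! ### Power series of Hilbert functions -/

/-! Hilbert depth is a property of the Hilbert series. A graded retract is a polynomial ring on its
linear forms, in r ≤ n variables, and has depth r. Graded spaces with finite-dimensional pieces are
classified by dimensions, so an ideal has a decomposition of depth at least p exactly when its
series is a finite sum of terms t^s/(1-t)^r with p ≤ r ≤ n (`exists_hilbertDecomposition`,
`mem_decomposable_of_le_hdepth`).

Counting monomials by support gives H(I_{n,d}) = H(m̂^d)/(1-t)^(d-1) (`supportSeries_eq`).
Multiplying a decomposition of H(m̂^d) by (1-t)^(-(d-1)) proves one inequality. The converse cannot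
just divide, since a decomposition of H(I_{n,d}) may have summands with r > p that do not match any
prescribed form. Instead, it implies that (1-t)^p H(m̂^d) has nonnegative coefficients for the
expected p. For the truncated series H(m̂^d) this positivity already suffices
(`tailSeries_mem_decomposable_of_coeff_nonneg`): from some degree on, (1-t)^p H(m̂^d) agrees with a
power of 1/(1-t), whose tail is decomposable, and what is left is a polynomial with nonnegative
coefficients. -/

/-- The geometric series `1 + t + t² + ⋯`. -/
def geomSeries : PowerSeries ℤ := PowerSeries.mk 1

theorem geomSeries_mul_one_sub : geomSeries * (1 - PowerSeries.X) = 1 :=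
  PowerSeries.mk_one_mul_one_sub_eq_one ℤ

theorem one_sub_pow_mul_geomSeries_pow (r : ℕ) :
    (1 - PowerSeries.X) ^ r * geomSeries ^ r = 1 := by
  rw [← mul_pow, mul_comm, geomSeries_mul_one_sub, one_pow]

theorem geomSeries_pow_succ (r : ℕ) :
    geomSeries ^ (r + 1) = PowerSeries.X * geomSeries ^ (r + 1) + geomSeries ^ r := by
  linear_combination geomSeries ^ r * geomSeries_mul_one_sub

/-- The exponent vectors in `n` variables of total degree `k` with at least `d` nonzero entries. -/
def exponents (n d k : ℕ) : Finset (Fin n → ℕ) :=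
  (Finset.Nat.antidiagonalTuple n k).filter
    fun m => d ≤ (Finset.univ.filter fun i => m i ≠ 0).card

theorem mem_exponents {n d k : ℕ} {m : Fin n → ℕ} :
    m ∈ exponents n d k ↔
      ∑ i, m i = k ∧ d ≤ (Finset.univ.filter fun i => m i ≠ 0).card := by
  simp [exponents, Finset.Nat.mem_antidiagonalTuple]

theorem card_filter_ne_zero_succ {n : ℕ} (m : Fin (n + 1) → ℕ) :
    (Finset.univ.filter fun i => m i ≠ 0).card =
      (if m 0 = 0 then 0 else 1) + (Finset.univ.filter fun i => Fin.tail m i ≠ 0).card := by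
  rw [Fin.card_filter_univ_succ]
  split_ifs <;> simp_all [Fin.tail, add_comm] <;> congr

/-- Split off the first exponent: if nonzero, it supplies one of the d required nonzero entries.
Truncation of `d - 1` at d = 0 is harmless, the condition being void. -/
theorem card_exponents_succ (n d k : ℕ) :
    (exponents (n + 1) d k).card = ∑ p ∈ Finset.HasAntidiagonal.antidiagonal k,
      (exponents n (if p.1 = 0 then d else d - 1) p.2).card := by
  rw [Finset.card_eq_sum_card_fiberwise (f := fun m => (m 0, ∑ i, Fin.tail m i))
    (t := Finset.HasAntidiagonal.antidiagonal k)]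
  · refine Finset.sum_congr rfl fun p hp => ?_
    refine Finset.card_nbij' Fin.tail (fun m => Fin.cons p.1 m) ?_ ?_ ?_ ?_
    · intro m hm
      simp only [Finset.coe_filter, Set.mem_ofPred_eq, mem_exponents, card_filter_ne_zero_succ] at hm
      obtain ⟨⟨h1, h2⟩, rfl⟩ := hm
      simp only [Finset.mem_coe, mem_exponents, true_and]
      split_ifs at h2 ⊢ <;> omega
    · intro m hm
      simp only [Finset.mem_coe, mem_exponents] at hm
      simp only [Finset.coe_filter, Set.mem_ofPred_eq, mem_exponents, card_filter_ne_zero_succ,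
        Fin.cons_zero, Fin.tail_cons, Fin.sum_cons]
      rw [Finset.HasAntidiagonal.mem_antidiagonal] at hp
      refine ⟨⟨by omega, ?_⟩, Prod.ext rfl hm.1⟩
      split_ifs at hm ⊢ <;> omega
    · intro m hm
      simp only [Finset.coe_filter, Set.mem_ofPred_eq] at hm
      rw [← hm.2]
      exact Fin.cons_self_tail m
    · intro m _
      exact Fin.tail_cons _ _
  · intro m hm
    simp only [Finset.mem_coe, mem_exponents, Fin.sum_univ_succ] at hm
    simpa [Fin.tail] using hm.1

/-- The generating function of the exponent vectors with at least `d` nonzero entries. -/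
def supportSeries (n d : ℕ) : PowerSeries ℤ :=
  PowerSeries.mk fun k => ((exponents n d k).card : ℤ)

theorem supportSeries_zero (n : ℕ) : supportSeries n 0 = geomSeries ^ n := by
  induction n with
  | zero =>
    ext k
    rw [supportSeries, PowerSeries.coeff_mk, pow_zero, PowerSeries.coeff_one]
    split_ifs with h
    · subst h; simp [exponents]
    · obtain ⟨j, rfl⟩ := Nat.exists_eq_succ_of_ne_zero h
      simp [exponents]
  | succ n ih =>
    rw [pow_succ', ← ih]
    ext k
    simp [supportSeries, geomSeries, PowerSeries.coeff_mul, card_exponents_succ]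

theorem supportSeries_succ_succ (n d : ℕ) :
    supportSeries (n + 1) (d + 1) =
      supportSeries n (d + 1) + PowerSeries.X * geomSeries * supportSeries n d := by
  ext k
  rw [map_add, PowerSeries.coeff_mul]
  have h : PowerSeries.coeff k (supportSeries n (d + 1)) = ∑ p ∈ Finset.HasAntidiagonal.antidiagonal k,
      if p.1 = 0 then PowerSeries.coeff p.2 (supportSeries n (d + 1)) else 0 := by
    have : PowerSeries.coeff k (1 * supportSeries n (d + 1)) = _ := PowerSeries.coeff_mul _ _ _
    simpa [PowerSeries.coeff_one] using this
  rw [h, ← Finset.sum_add_distrib, supportSeries, PowerSeries.coeff_mk, card_exponents_succ,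
    Nat.cast_sum]
  refine Finset.sum_congr rfl fun p _ => ?_
  obtain ⟨i, j⟩ := p
  cases i with
  | zero => simp [supportSeries]
  | succ i => simp [supportSeries, geomSeries, PowerSeries.coeff_succ_X_mul]

/-- The part of degree at least `d` of the Hilbert series of the polynomial ring in `N`
variables. -/
def tailSeries (N d : ℕ) : PowerSeries ℤ :=
  PowerSeries.mk fun k => if d ≤ k then PowerSeries.coeff k (geomSeries ^ N) else 0

theorem coeff_tailSeries (N d k : ℕ) : PowerSeries.coeff k (tailSeries N d) =
    if d ≤ k then PowerSeries.coeff k (geomSeries ^ N) else 0 := by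
  rw [tailSeries, PowerSeries.coeff_mk]

theorem tailSeries_zero_right (N : ℕ) : tailSeries N 0 = geomSeries ^ N := by
  ext k; simp [coeff_tailSeries]

theorem tailSeries_zero_left (d : ℕ) : tailSeries 0 (d + 1) = 0 := by
  ext k
  rw [coeff_tailSeries, pow_zero, PowerSeries.coeff_one, map_zero]
  split_ifs <;> omega

/-- Truncate `geomSeries_pow_succ` below degree d + 1; the factor t lowers the cutoff of its term to
d. -/
theorem tailSeries_succ_succ (N d : ℕ) : tailSeries (N + 1) (d + 1) =
    PowerSeries.X * tailSeries (N + 1) d + tailSeries N (d + 1) := by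
  ext k
  cases k with
  | zero => simp [tailSeries]
  | succ k =>
    have h := congrArg (PowerSeries.coeff (k + 1)) (geomSeries_pow_succ N)
    rw [map_add, PowerSeries.coeff_succ_X_mul] at h
    rw [map_add, PowerSeries.coeff_succ_X_mul, coeff_tailSeries, coeff_tailSeries,
      coeff_tailSeries, h]
    by_cases hk : d ≤ k <;> simp [hk]

theorem supportSeries_eq_zero {n d : ℕ} (h : n < d) : supportSeries n d = 0 := by
  ext k
  have : exponents n d k = ∅ := by
    refine Finset.filter_eq_empty_iff.2 fun m _ => not_le.2 (lt_of_le_of_lt ?_ h)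
    exact (Finset.card_filter_le _ _).trans (by simp)
  simp [supportSeries, this]

theorem supportSeries_one (N : ℕ) : supportSeries N 1 = tailSeries N 1 := by
  ext k
  rw [coeff_tailSeries, ← supportSeries_zero, supportSeries, supportSeries, PowerSeries.coeff_mk,
    PowerSeries.coeff_mk]
  have key : ∀ m : Fin N → ℕ,
      1 ≤ (Finset.univ.filter fun i => m i ≠ 0).card ↔ 1 ≤ ∑ i, m i := by
    intro m
    rw [Nat.one_le_iff_ne_zero, Nat.one_le_iff_ne_zero, not_iff_not, Finset.card_eq_zero,
      Finset.filter_eq_empty_iff, Finset.sum_eq_zero_iff]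
    simp
  split_ifs with hk
  · congr 2
    ext m
    rw [mem_exponents, mem_exponents, key]
    refine and_congr_right fun h => ?_
    simp [h, hk]
  · rw [Nat.cast_eq_zero, Finset.card_eq_zero, Finset.eq_empty_iff_forall_notMem]
    intro m hm
    rw [mem_exponents, key] at hm
    omega

/-- Both sides satisfy the same recursion: `supportSeries_succ_succ` on the left,
`tailSeries_succ_succ` times 1/(1-t)^d on the right. Hence a double induction. -/
theorem supportSeries_add (N d : ℕ) :
    supportSeries (N + d) (d + 1) = tailSeries N (d + 1) * geomSeries ^ d := by
  induction d generalizing N with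
  | zero => simp [supportSeries_one]
  | succ d ih =>
    induction N with
    | zero => rw [supportSeries_eq_zero (by omega), tailSeries_zero_left, zero_mul]
    | succ N ihN =>
      rw [← add_assoc, supportSeries_succ_succ, ih (N + 1), add_right_comm, add_assoc N d 1, ihN,
        tailSeries_succ_succ N (d + 1)]
      ring

theorem supportSeries_eq {n d : ℕ} (hd : 1 ≤ d) (hdn : d ≤ n) :
    supportSeries n d = tailSeries (n - d + 1) d * geomSeries ^ (d - 1) := by
  obtain ⟨e, rfl⟩ := Nat.exists_eq_add_of_le' hd
  have := supportSeries_add (n - e) e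
  rwa [Nat.sub_add_cancel (by omega), show n - e = n - (e + 1) + 1 by omega] at this

/-- The series that are sums of Hilbert series `t ^ s / (1 - t) ^ r` with `p ≤ r ≤ n`. -/
def decomposable (p n : ℕ) : AddSubmonoid (PowerSeries ℤ) :=
  AddSubmonoid.closure
    {f | ∃ r s : ℕ, p ≤ r ∧ r ≤ n ∧ f = PowerSeries.X ^ s * geomSeries ^ r}

theorem X_pow_mul_geomSeries_pow_mem {p n r : ℕ} (s : ℕ) (hp : p ≤ r) (hn : r ≤ n) :
    PowerSeries.X ^ s * geomSeries ^ r ∈ decomposable p n :=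
  AddSubmonoid.subset_closure ⟨r, s, hp, hn, rfl⟩

theorem X_mul_mem_decomposable {p n : ℕ} {f : PowerSeries ℤ} (hf : f ∈ decomposable p n) :
    PowerSeries.X * f ∈ decomposable p n := by
  induction hf using AddSubmonoid.closure_induction with
  | mem f hf =>
    obtain ⟨r, s, hp, hn, rfl⟩ := hf
    rw [← mul_assoc, ← pow_succ']
    exact X_pow_mul_geomSeries_pow_mem _ hp hn
  | zero => simp
  | add f g _ _ hf hg => rw [mul_add]; exact add_mem hf hg

theorem decomposable_mono {p p' n n' : ℕ} (hp : p' ≤ p) (hn : n ≤ n') :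
    decomposable p n ≤ decomposable p' n' :=
  AddSubmonoid.closure_mono fun _ ⟨r, s, h, h', e⟩ => ⟨r, s, hp.trans h, h'.trans hn, e⟩

theorem mul_geomSeries_pow_mem {p n : ℕ} (e : ℕ) {f : PowerSeries ℤ}
    (hf : f ∈ decomposable p n) : f * geomSeries ^ e ∈ decomposable (p + e) (n + e) := by
  induction hf using AddSubmonoid.closure_induction with
  | mem f hf =>
    obtain ⟨r, s, hp, hn, rfl⟩ := hf
    rw [mul_assoc, ← pow_add]
    exact X_pow_mul_geomSeries_pow_mem _ (by omega) (by omega)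
  | zero => simp
  | add f g _ _ hf hg => rw [add_mul]; exact add_mem hf hg

theorem coeff_geomSeries_pow_nonneg (r k : ℕ) : 0 ≤ PowerSeries.coeff k (geomSeries ^ r) := by
  rw [← supportSeries_zero, supportSeries, PowerSeries.coeff_mk]
  positivity

/-- Each summand keeps a pole of order at least p, so (1-t)^p cancels and leaves t^s/(1-t)^(r-p). -/
theorem coeff_nonneg_of_mem_decomposable {p n : ℕ} {f : PowerSeries ℤ}
    (hf : f ∈ decomposable p n) (k : ℕ) :
    0 ≤ PowerSeries.coeff k ((1 - PowerSeries.X) ^ p * f) := by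
  induction hf using AddSubmonoid.closure_induction with
  | mem f hf =>
    obtain ⟨r, s, hp, hn, rfl⟩ := hf
    obtain ⟨e, rfl⟩ := Nat.exists_eq_add_of_le hp
    have : (1 - PowerSeries.X) ^ p * (PowerSeries.X ^ s * geomSeries ^ (p + e)) =
        PowerSeries.X ^ s * geomSeries ^ e := by
      rw [pow_add]
      linear_combination
        PowerSeries.X ^ s * geomSeries ^ e * one_sub_pow_mul_geomSeries_pow p
    rw [this, PowerSeries.coeff_X_pow_mul']
    split_ifs
    · exact coeff_geomSeries_pow_nonneg _ _
    · rfl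
  | zero => simp
  | add f g _ _ hf hg => rw [mul_add, map_add]; exact add_nonneg hf hg

theorem tailSeries_mem_decomposable (N d : ℕ) : tailSeries N d ∈ decomposable 0 N := by
  induction d generalizing N with
  | zero =>
    rw [tailSeries_zero_right, ← one_mul (geomSeries ^ N), ← pow_zero PowerSeries.X]
    exact X_pow_mul_geomSeries_pow_mem 0 (Nat.zero_le _) le_rfl
  | succ d ih =>
    induction N with
    | zero => rw [tailSeries_zero_left]; exact zero_mem _
    | succ N ihN =>
      rw [tailSeries_succ_succ]
      exact add_mem (X_mul_mem_decomposable (ih _)) (decomposable_mono le_rfl (Nat.le_succ N) ihN)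

/-- A polynomial with nonnegative coefficients is a sum of terms with r = 0, that is, of shifted
copies of K. -/
theorem mem_decomposable_of_coeff_nonneg {f : PowerSeries ℤ} (D n : ℕ)
    (h0 : ∀ k < D, 0 ≤ PowerSeries.coeff k f) (h : ∀ k, D ≤ k → PowerSeries.coeff k f = 0) :
    f ∈ decomposable 0 n := by
  have : f = ∑ i ∈ Finset.range D,
      (PowerSeries.coeff i f).toNat • (PowerSeries.X ^ i * geomSeries ^ 0) := by
    ext k
    rw [map_sum]
    simp only [pow_zero, mul_one, map_nsmul, PowerSeries.coeff_X_pow, smul_ite, smul_zero,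
      Finset.sum_ite_eq, Finset.mem_range]
    split_ifs with hk
    · simp [Int.toNat_of_nonneg (h0 k hk)]
    · exact h k (not_lt.1 hk)
  rw [this]
  exact sum_mem fun i _ =>
    nsmul_mem (X_pow_mul_geomSeries_pow_mem i (Nat.zero_le _) (Nat.zero_le _)) _

theorem coeff_one_sub_pow_mul_eq_zero {h : PowerSeries ℤ} {D : ℕ}
    (hD : ∀ k, D ≤ k → PowerSeries.coeff k h = 0) (p : ℕ) :
    ∀ k, D + p ≤ k → PowerSeries.coeff k ((1 - PowerSeries.X) ^ p * h) = 0 := by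
  induction p with
  | zero => simpa using hD
  | succ p ih =>
    intro k hk
    obtain ⟨j, rfl⟩ : ∃ j, k = j + 1 := ⟨k - 1, by omega⟩
    rw [pow_succ', mul_assoc, sub_mul, one_mul, map_sub, PowerSeries.coeff_succ_X_mul,
      ih _ (by omega), ih _ (by omega), sub_zero]

/-- With N = p + e, write (1-t)^p times the series as a polynomial of degree below d + p plus the
tail of 1/(1-t)^e from degree d + p. Positivity is needed only for the polynomial. Multiplying by
1/(1-t)^p then raises every r into the range from p to N. -/
theorem tailSeries_mem_decomposable_of_coeff_nonneg {N d p : ℕ} (hp : p ≤ N)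
    (h : ∀ k, 0 ≤ PowerSeries.coeff k ((1 - PowerSeries.X) ^ p * tailSeries N d)) :
    tailSeries N d ∈ decomposable p N := by
  obtain ⟨e, rfl⟩ := Nat.exists_eq_add_of_le hp
  set g := (1 - PowerSeries.X) ^ p * tailSeries (p + e) d with hg
  -- The truncated-off part is a polynomial of degree below d, so (1-t)^p times it vanishes from
  -- degree d + p on.
  have hge : g = geomSeries ^ e -
      (1 - PowerSeries.X) ^ p * (geomSeries ^ (p + e) - tailSeries (p + e) d) := by
    rw [mul_sub, ← hg, pow_add]
    linear_combination geomSeries ^ e * one_sub_pow_mul_geomSeries_pow p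
  have hcoeff : ∀ k, d + p ≤ k →
      PowerSeries.coeff k g = PowerSeries.coeff k (geomSeries ^ e) := by
    intro k hk
    rw [hge, map_sub, coeff_one_sub_pow_mul_eq_zero (D := d) _ p k hk, sub_zero]
    intro j hj
    rw [map_sub, coeff_tailSeries, if_pos hj, sub_self]
  have hmem : g ∈ decomposable 0 e := by
    rw [← sub_add_cancel g (tailSeries e (d + p))]
    refine add_mem (mem_decomposable_of_coeff_nonneg (d + p) e ?_ ?_)
      (tailSeries_mem_decomposable _ _)
    · intro k hk
      rw [map_sub, coeff_tailSeries, if_neg (by omega), sub_zero]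
      exact h k
    · intro k hk
      rw [map_sub, coeff_tailSeries, if_pos hk, hcoeff k hk, sub_self]
  have := mul_geomSeries_pow_mem p hmem
  rw [zero_add, add_comm e p] at this
  convert this using 1
  linear_combination -tailSeries (p + e) d * one_sub_pow_mul_geomSeries_pow p

/-! ### Regular sequences in polynomial rings -/

/-- Each further element is a nonzerodivisor modulo its predecessors, so factoring it out lowers the
dimension by at least one. -/
theorem ringKrullDim_quotient_ofList_add_length_le {A : Type*} [CommRing A] (rs : List A)
    (h : RingTheory.Sequence.IsWeaklyRegular A rs) :
    ringKrullDim (A ⧸ Ideal.ofList rs) + (rs.length : WithBot ℕ∞) ≤ ringKrullDim A := by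
  induction rs using List.reverseRecOn with
  | nil =>
    simpa using ringKrullDim_le_of_surjective (Ideal.Quotient.mk (Ideal.ofList ([] : List A)))
      Ideal.Quotient.mk_surjective
  | append_singleton rs a ih =>
    rw [RingTheory.Sequence.isWeaklyRegular_append_iff,
      RingTheory.Sequence.isWeaklyRegular_singleton_iff,
      isSMulRegular_quotient_iff_mem_of_smul_mem, smul_eq_mul, Ideal.mul_top] at h
    have hle : Ideal.ofList rs ≤ Ideal.ofList (rs ++ [a]) := by
      rw [Ideal.ofList_append]; exact le_sup_left
    have ha : a ∈ Ideal.ofList (rs ++ [a]) := Ideal.subset_span (by simp)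
    have hreg : Ideal.Quotient.mk (Ideal.ofList rs) a ∈
        nonZeroDivisors (A ⧸ Ideal.ofList rs) := by
      rw [mem_nonZeroDivisors_iff_right]
      intro z hz
      obtain ⟨x, rfl⟩ := Ideal.Quotient.mk_surjective z
      rw [← map_mul, Ideal.Quotient.eq_zero_iff_mem, mul_comm] at hz
      exact Ideal.Quotient.eq_zero_iff_mem.2 (h.2 x hz)
    have key := ringKrullDim_succ_le_of_surjective (Ideal.Quotient.factor hle)
      (Ideal.Quotient.factor_surjective hle) hreg
      (by rw [Ideal.Quotient.factor_mk]; exact Ideal.Quotient.eq_zero_iff_mem.2 ha)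
    refine le_trans ?_ (ih h.1)
    rw [List.length_append, List.length_singleton, Nat.cast_add, Nat.cast_one,
      add_comm (rs.length : WithBot ℕ∞), ← add_assoc]
    gcongr

theorem length_le_ringKrullDim_of_isRegular {A : Type*} [CommRing A] (rs : List A)
    (h : RingTheory.Sequence.IsRegular A rs) : (rs.length : WithBot ℕ∞) ≤ ringKrullDim A := by
  have hne : Ideal.ofList rs ≠ ⊤ := fun hT =>
    h.top_ne_smul (by rw [smul_eq_mul, Ideal.mul_top, hT])
  have : Nontrivial (A ⧸ Ideal.ofList rs) := Ideal.Quotient.nontrivial_iff.2 hne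
  refine le_trans ?_ (ringKrullDim_quotient_ofList_add_length_le rs h.toIsWeaklyRegular)
  exact le_add_of_nonneg_left ringKrullDim_nonneg_of_nontrivial

/-- Membership is tested on exponents, and multiplying by a variable outside s leaves the exponents
of the variables in s unchanged. -/
theorem mem_span_X_image_of_X_mul_mem {σ R : Type*} [CommRing R] {s : Set σ} {i : σ} (hi : i ∉ s)
    {f : MvPolynomial σ R} (hf : X i * f ∈ Ideal.span (X '' s : Set (MvPolynomial σ R))) :
    f ∈ Ideal.span (X '' s : Set (MvPolynomial σ R)) := by
  rw [mem_ideal_span_X_image] at hf ⊢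
  intro m hm
  have : Finsupp.single i 1 + m ∈ (X i * f).support := by
    rw [mem_support_iff, coeff_X_mul]
    exact mem_support_iff.1 hm
  obtain ⟨j, hj, hne⟩ := hf _ this
  refine ⟨j, hj, ?_⟩
  have hji : i ≠ j := fun h => hi (h ▸ hj)
  simpa [Finsupp.single_apply, hji] using hne

theorem isRegular_ofFn_X (K : Type*) [Field K] (r : ℕ) :
    RingTheory.Sequence.IsRegular (MvPolynomial (Fin r) K)
      (List.ofFn (X : Fin r → MvPolynomial (Fin r) K)) := by
  refine ⟨⟨fun i hi => ?_⟩, fun h => ?_⟩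
  · rw [isSMulRegular_quotient_iff_mem_of_smul_mem, smul_eq_mul, Ideal.mul_top]
    rw [List.length_ofFn] at hi
    have hset : {f : MvPolynomial (Fin r) K | f ∈ (List.ofFn X).take i} =
        X '' {j : Fin r | (j : ℕ) < i} := by
      ext f
      simp only [Set.mem_ofPred_eq, List.mem_take_iff_getElem, List.length_ofFn, Set.mem_image,
        List.getElem_ofFn]
      constructor
      · rintro ⟨j, hj, rfl⟩
        exact ⟨⟨j, by omega⟩, by simpa using (by omega : j < i), rfl⟩
      · rintro ⟨j, hj, rfl⟩
        exact ⟨j, lt_min hj j.2, rfl⟩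
    intro f hf
    rw [Ideal.ofList, hset] at hf ⊢
    rw [List.getElem_ofFn] at hf
    exact mem_span_X_image_of_X_mul_mem (by simp) hf
  · rw [smul_eq_mul, Ideal.mul_top, eq_comm, Ideal.eq_top_iff_one] at h
    have hset : {f : MvPolynomial (Fin r) K | f ∈ List.ofFn X} = X '' Set.univ := by
      ext f
      simp [List.mem_ofFn]
    rw [Ideal.ofList, hset, mem_ideal_span_X_image] at h
    obtain ⟨j, _, hj⟩ := h 0 (by simp)
    exact hj rfl

/-! ### Hilbert functions of monomial subspaces -/

theorem mem_restrictSupport {K : Type*} [Field K] {n : ℕ} {P : Set (Fin n →₀ ℕ)}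
    {f : MvPolynomial (Fin n) K} : f ∈ restrictSupport K P ↔ ∀ m ∈ f.support, m ∈ P :=
  Iff.rfl

theorem finrank_restrictSupport (K : Type*) [Field K] {n : ℕ} (P : Set (Fin n →₀ ℕ))
    (s : Finset (Fin n → ℕ)) (h : ∀ m : Fin n →₀ ℕ, m ∈ P ↔ ⇑m ∈ s) :
    Module.Finite K (restrictSupport K P) ∧ Module.finrank K (restrictSupport K P) = s.card := by
  let e : P ≃ s := Finsupp.equivFunOnFinite.subtypeEquiv h
  have : Finite P := Finite.of_equiv _ e.symm
  refine ⟨Module.Finite.of_basis (basisRestrictSupport K P), ?_⟩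
  rw [Module.finrank_eq_nat_card_basis (basisRestrictSupport K P), Nat.card_congr e]
  simp

/-- The Hilbert function of the polynomial ring in `r` variables. -/
def polyHilbert (r : ℕ) : ℤ → ℕ
  | Int.ofNat k => (exponents r 0 k).card
  | Int.negSucc _ => 0

theorem polyPart_finrank (K : Type*) [Field K] (r : ℕ) (k : ℤ) :
    Module.Finite K (polyPart K r k) ∧ Module.finrank K (polyPart K r k) = polyHilbert r k := by
  cases k with
  | ofNat k =>
    have := finrank_restrictSupport K {m : Fin r →₀ ℕ | m.degree = k} (exponents r 0 k)
      (fun m => by simp [mem_exponents, Finsupp.degree_eq_sum])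
    rwa [restrictSupport, ← homogeneousSubmodule_eq_finsupp_supported] at this
  | negSucc k => exact ⟨inferInstanceAs (Module.Finite K (⊥ : Submodule K _)), finrank_bot K _⟩

theorem coeff_X_pow_mul_geomSeries_pow (r s k : ℕ) :
    PowerSeries.coeff k (PowerSeries.X ^ s * geomSeries ^ r) =
      (polyHilbert r ((k : ℤ) - (s : ℤ)) : ℤ) := by
  rw [PowerSeries.coeff_X_pow_mul', ← supportSeries_zero]
  split_ifs with h
  · rw [← Nat.cast_sub h, supportSeries, PowerSeries.coeff_mk]
    rfl
  · obtain ⟨j, hj⟩ : ∃ j : ℕ, (k : ℤ) - s = Int.negSucc j := Int.eq_negSucc_of_lt_zero (by omega)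
    rw [hj]
    rfl

theorem polyHilbert_zero (r : ℕ) : polyHilbert r 0 ≠ 0 := by
  have : (exponents r 0 0).card ≠ 0 := by
    simp [exponents, Finset.Nat.antidiagonalTuple_zero_right]
  exact this

theorem polyHilbert_of_neg (r : ℕ) {k : ℤ} (hk : k < 0) : polyHilbert r k = 0 := by
  obtain ⟨j, rfl⟩ := Int.eq_negSucc_of_lt_zero hk
  rfl

/-! ### Graded retracts are polynomial rings -/

namespace GradedRetract

variable {K : Type*} [Field K] {n : ℕ}

/-- The retract `S` is, as a graded algebra, a polynomial ring in `r` variables. -/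
def HasRank (S : GradedRetract K n) (r : ℕ) : Prop :=
  ∃ φ : MvPolynomial (Fin r) K ≃ₐ[K] S.algebra,
    ∀ m f, (φ f : MvPolynomial (Fin n) K).IsHomogeneous m ↔ f.IsHomogeneous m

/-- The left inverse h gives injectivity, and being linear it also reflects homogeneity. -/
theorem HasRank.of_leftInverse {S : GradedRetract K n} {r : ℕ} (g : Fin r → MvPolynomial (Fin n) K)
    (h : Fin n → MvPolynomial (Fin r) K) (hg : ∀ i, (g i).IsHomogeneous 1)
    (hh : ∀ j, (h j).IsHomogeneous 1) (hgh : ∀ i, aeval h (g i) = X i)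
    (hgS : ∀ i, g i ∈ S.algebra) (hS : ∀ j, S.proj (X j) ∈ (aeval (R := K) g).range) :
    S.HasRank r := by
  have hinv : ∀ f : MvPolynomial (Fin r) K, aeval h (aeval g f) = f := by
    intro f
    have : (aeval h).comp (aeval g) = AlgHom.id K (MvPolynomial (Fin r) K) := by
      ext i : 1
      rw [AlgHom.comp_apply, aeval_X, hgh, AlgHom.id_apply]
    exact DFunLike.congr_fun this f
  have hmem : ∀ f, aeval g f ∈ S.algebra := fun f => by
    have : (aeval (R := K) g).range ≤ S.algebra := by
      rw [← Algebra.adjoin_range_eq_range_aeval]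
      exact Algebra.adjoin_le (by rintro _ ⟨i, rfl⟩; exact hgS i)
    exact this ⟨f, rfl⟩
  have hrange : S.algebra ≤ (aeval (R := K) g).range := by
    rintro _ ⟨f, rfl⟩
    have : S.proj = aeval fun j => S.proj (X j) := by ext j : 1; simp
    rw [this]
    have : (aeval (R := K) fun j => S.proj (X j)).range ≤ (aeval (R := K) g).range := by
      rw [← Algebra.adjoin_range_eq_range_aeval]
      exact Algebra.adjoin_le (by rintro _ ⟨i, rfl⟩; exact hS i)
    exact this ⟨f, rfl⟩
  refine ⟨AlgEquiv.ofBijective ((aeval g).codRestrict S.algebra hmem) ⟨?_, ?_⟩, fun m f => ?_⟩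
  · intro a b hab
    have hval := congrArg Subtype.val hab
    rw [AlgHom.coe_codRestrict, AlgHom.coe_codRestrict] at hval
    rw [← hinv a, hval, hinv]
  · rintro ⟨x, hx⟩
    obtain ⟨f, hf⟩ := hrange hx
    exact ⟨f, Subtype.ext hf⟩
  · change (aeval g f).IsHomogeneous m ↔ _
    refine ⟨fun hf => ?_, fun hf => ?_⟩
    · rw [← hinv f, ← one_mul m]
      exact hf.aeval h hh
    · rw [← one_mul m]
      exact hf.aeval g hg

/-- The retract is generated by the linear forms `S.proj (X j)`, hence by a basis of its degree-one
part V. These basis elements are algebraically independent because a linear change of coordinates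
sends them to variables. -/
theorem exists_hasRank (S : GradedRetract K n) : ∃ r ≤ n, S.HasRank r := by
  have hX := homogeneousSubmodule_one_eq_span_X (σ := Fin n) (R := K)
  have hfin : Module.Finite K (homogeneousSubmodule (Fin n) K 1) := by
    rw [hX]; exact Module.Finite.span_of_finite K (Set.finite_range _)
  let V : Submodule K (MvPolynomial (Fin n) K) :=
    homogeneousSubmodule (Fin n) K 1 ⊓ Subalgebra.toSubmodule S.algebra
  have hVfin : Module.Finite K V := Submodule.finiteDimensional_inf_left _ _
  have hVn : Module.finrank K V ≤ n := by
    refine (Submodule.finrank_mono (inf_le_left : V ≤ homogeneousSubmodule (Fin n) K 1)).trans ?_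
    rw [hX]
    exact (finrank_range_le_card _).trans (by simp)
  -- A linear projection onto V; expanding its values on the variables in the basis b defines the
  -- left inverse h.
  obtain ⟨p, hp⟩ := V.subtype.exists_leftInverse_of_injective V.ker_subtype
  let b := Module.finBasis K V
  let h : Fin n → MvPolynomial (Fin (Module.finrank K V)) K :=
    fun j => ∑ i, C (b.repr (p (X j)) i) * X i
  have hlin : ∀ f ∈ homogeneousSubmodule (Fin n) K 1,
      aeval h f = ∑ i, C (b.repr (p f) i) * X i := by
    intro f hf
    rw [hX] at hf
    induction hf using Submodule.span_induction with
    | mem f hf => obtain ⟨j, rfl⟩ := hf; simp [h]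
    | zero => simp
    | add f g _ _ hf hg => rw [map_add, hf, hg]; simp [add_mul, Finset.sum_add_distrib]
    | smul a f _ hf =>
      rw [map_smul, hf, map_smul, map_smul]
      simp [Finset.smul_sum, smul_eq_C_mul, mul_assoc]
  refine ⟨_, hVn, HasRank.of_leftInverse (fun i => (b i : MvPolynomial (Fin n) K)) h
    (fun i => (b i).2.1) (fun j => ?_) (fun i => ?_) (fun i => (b i).2.2) fun j => ?_⟩
  · exact IsHomogeneous.sum _ _ _ fun i _ => isHomogeneous_C_mul_X _ _
  · rw [hlin _ (b i).2.1]
    have : p (b i) = b i := DFunLike.congr_fun hp (b i)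
    rw [this, b.repr_self, Finset.sum_eq_single i]
    · simp
    · intro j _ hj; simp [hj.symm]
    · simp
  · let v : V := ⟨S.proj (X j), S.proj_mem 1 _ (isHomogeneous_X K j), ⟨X j, rfl⟩⟩
    refine ⟨∑ i, C (b.repr v i) * X i, ?_⟩
    have := congrArg (Subtype.val) (b.sum_repr v)
    rw [AddSubmonoidClass.coe_finsetSum] at this
    simp only [AlgHom.toRingHom_eq_coe, RingHom.coe_coe, map_sum, map_mul, aeval_X, algHom_C,
      ← Algebra.smul_def]
    exact this

/-- The retraction onto the polynomial ring in the first `r` variables. -/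
def coordinate (K : Type*) [Field K] {n r : ℕ} (_ : r ≤ n) : GradedRetract K n where
  proj := aeval fun j => if (j : ℕ) < r then X j else 0
  proj_mem m f hf := by
    rw [← one_mul m]
    refine IsHomogeneous.aeval hf _ fun j => ?_
    split_ifs
    exacts [isHomogeneous_X _ _, isHomogeneous_zero _ _ _]
  proj_proj f := by
    rw [← AlgHom.comp_apply]
    congr 1
    ext j : 1
    by_cases hj : (j : ℕ) < r <;> simp [hj]

theorem coordinate_hasRank {r : ℕ} (hr : r ≤ n) : (coordinate K hr).HasRank r := by
  refine HasRank.of_leftInverse (fun i => X (Fin.castLE hr i))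
    (fun j => if hj : (j : ℕ) < r then X ⟨j, hj⟩ else 0) (fun i => isHomogeneous_X _ _)
    (fun j => ?_) (fun i => ?_) (fun i => ⟨X (Fin.castLE hr i), ?_⟩) fun j => ?_
  · split_ifs
    exacts [isHomogeneous_X _ _, isHomogeneous_zero _ _ _]
  · simp
  · simp [coordinate]
  · by_cases hj : (j : ℕ) < r
    · exact ⟨X ⟨j, hj⟩, by simp [coordinate, hj]⟩
    · exact ⟨0, by simp [coordinate, hj]⟩

/-- Krull dimension bounds the depth from above; the images of the variables form a regular sequence
of length r. -/
theorem HasRank.depth_eq {S : GradedRetract K n} {r : ℕ} (h : S.HasRank r) : S.depth = r := by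
  obtain ⟨φ, hφ⟩ := h
  apply le_antisymm
  · refine iSup₂_le fun rs hrs => ?_
    have h1 := length_le_ringKrullDim_of_isRegular rs hrs.2
    rw [← ringKrullDim_eq_of_ringEquiv φ.toRingEquiv, ringKrullDim_of_isNoetherianRing,
      ringKrullDim_eq_zero_of_field, zero_add, Nat.card_eq_fintype_card, Fintype.card_fin] at h1
    exact_mod_cast h1
  · refine le_iSup₂_of_le ((List.ofFn X).map φ) ⟨fun f hf => ?_, ?_⟩ (by simp)
    · rw [List.mem_map] at hf
      obtain ⟨x, hx, rfl⟩ := hf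
      obtain ⟨i, rfl⟩ := List.mem_ofFn.1 hx
      change (φ (X i) : MvPolynomial (Fin n) K) ∈ idealOfVars (Fin n) K
      rw [← pow_one (idealOfVars (Fin n) K), mem_pow_idealOfVars_iff]
      intro m hm
      by_contra hlt
      exact mem_support_iff.1 hm
        (((hφ 1 (X i)).2 (isHomogeneous_X _ _)).coeff_eq_zero (by omega))
    · refine (AddEquiv.isRegular_congr (e := φ.toRingEquiv.toAddEquiv) ?_).1 (isRegular_ofFn_X K r)
      exact List.forall₂_map_right_iff.mpr (List.forall₂_same.mpr fun a _ x => map_mul φ a x)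

theorem HasRank.shiftedPart_eq {S : GradedRetract K n} {r : ℕ} (h : S.HasRank r) (s k : ℤ) :
    Module.Finite K (S.shiftedPart s k) ∧
      Module.finrank K (S.shiftedPart s k) = polyHilbert r (k - s) := by
  obtain ⟨φ, hφ⟩ := h
  have key : S.shiftedPart s k =
      (polyPart K r (k - s)).map (φ.toLinearEquiv : _ →ₗ[K] S.algebra) := by
    rw [shiftedPart]
    ext x
    obtain ⟨f, rfl⟩ := φ.surjective x
    have hm : φ f ∈ (polyPart K r (k - s)).map (φ.toLinearEquiv : _ →ₗ[K] S.algebra) ↔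
        f ∈ polyPart K r (k - s) := by
      rw [Submodule.mem_map]
      exact ⟨fun ⟨y, hy, e⟩ => φ.injective e ▸ hy, fun hf => ⟨f, hf, rfl⟩⟩
    rw [hm]
    cases k - s with
    | ofNat m => exact hφ m f
    | negSucc m =>
      change (φ f : MvPolynomial (Fin n) K) = 0 ↔ f = 0
      simp
  have := polyPart_finrank K r (k - s)
  have := this.1
  rw [key]
  exact ⟨inferInstance, by rw [LinearEquiv.finrank_map_eq, (polyPart_finrank K r (k - s)).2]⟩

end GradedRetract

/-! ### Graded vector spaces -/

section Graded

variable {K : Type*} [Field K] {M N : Type*} [AddCommGroup M] [Module K M]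
  [AddCommGroup N] [Module K N]

theorem isInternal_pi {κ ι : Type*} [DecidableEq κ] [Fintype ι] [DecidableEq ι] {V : ι → Type*}
    [∀ i, AddCommGroup (V i)] [∀ i, Module K (V i)] (𝒱 : ∀ i, κ → Submodule K (V i))
    (h : ∀ i, DirectSum.IsInternal (𝒱 i)) :
    DirectSum.IsInternal fun k => Submodule.pi Set.univ fun i => 𝒱 i k := by
  simp only [DirectSum.isInternal_submodule_iff_iSupIndep_and_iSup_eq_top] at h ⊢
  constructor
  · intro k
    rw [Submodule.disjoint_def]
    intro x hx hx'
    funext i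
    refine (Submodule.disjoint_def.1 ((h i).1 k)) _ (hx i trivial) ?_
    have : (⨆ j, ⨆ (_ : j ≠ k), Submodule.pi Set.univ fun i => 𝒱 i j) ≤
        (⨆ j, ⨆ (_ : j ≠ k), 𝒱 i j).comap (LinearMap.proj i) :=
      iSup₂_le fun j hj y hy => Submodule.mem_iSup_of_mem j
        (Submodule.mem_iSup_of_mem hj (hy i trivial))
    exact this hx'
  · rw [eq_top_iff, ← Submodule.pi_top Set.univ, ← Submodule.iSup_map_single]
    refine iSup_le fun i => ?_
    rw [← (h i).2, Submodule.map_iSup]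
    refine iSup_mono fun k => ?_
    rw [Submodule.map_le_iff_le_comap]
    exact Submodule.le_comap_single_pi fun i => 𝒱 i k

theorem finrank_pi_submodule {ι : Type*} [Fintype ι] {V : ι → Type*}
    [∀ i, AddCommGroup (V i)] [∀ i, Module K (V i)] (p : ∀ i, Submodule K (V i))
    (h : ∀ i, Module.Finite K (p i)) :
    Module.Finite K (Submodule.pi Set.univ p) ∧
      Module.finrank K (Submodule.pi Set.univ p) = ∑ i, Module.finrank K (p i) := by
  let e : Submodule.pi Set.univ p ≃ₗ[K] ∀ i, p i :=
    { toFun := fun x i => ⟨x.1 i, x.2 i trivial⟩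
      invFun := fun x => ⟨fun i => x i, fun i _ => (x i).2⟩
      map_add' := fun _ _ => rfl
      map_smul' := fun _ _ => rfl }
  exact ⟨Module.Finite.equiv e.symm, by rw [e.finrank_eq, Module.finrank_pi_fintype]⟩

theorem exists_gradedEquiv {κ : Type*} [DecidableEq κ] {ℳ : κ → Submodule K M}
    {𝒩 : κ → Submodule K N} (hM : DirectSum.IsInternal ℳ) (hN : DirectSum.IsInternal 𝒩)
    (e : ∀ k, ℳ k ≃ₗ[K] 𝒩 k) :
    ∃ E : M ≃ₗ[K] N, ∀ k, (ℳ k).map E.toLinearMap = 𝒩 k := by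
  let eM := LinearEquiv.ofBijective (DirectSum.coeLinearMap ℳ) hM
  let eN := LinearEquiv.ofBijective (DirectSum.coeLinearMap 𝒩) hN
  let E := eM.symm ≪≫ₗ DFinsupp.mapRange.linearEquiv e ≪≫ₗ eN
  have hE : ∀ k (x : ℳ k), E x = e k x := by
    intro k x
    have h1 : eM.symm x = DirectSum.lof K κ (fun k => ℳ k) k x := by
      rw [LinearEquiv.symm_apply_eq]
      exact (DirectSum.coeLinearMap_lof ℳ k x).symm
    have h2 : DFinsupp.mapRange.linearEquiv e (DirectSum.lof K κ (fun k => ℳ k) k x) =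
        DirectSum.lof K κ (fun k => 𝒩 k) k (e k x) := by
      exact DFinsupp.mapRange_single (hf := fun i => map_zero (e i))
    change eN (DFinsupp.mapRange.linearEquiv e (eM.symm x)) = _
    rw [h1, h2]
    exact DirectSum.coeLinearMap_lof 𝒩 k (e k x)
  refine ⟨E, fun k => le_antisymm ?_ fun y hy => ?_⟩
  · rintro _ ⟨x, hx, rfl⟩
    have := hE k ⟨x, hx⟩
    change E x ∈ _
    rw [this]
    exact (e k ⟨x, hx⟩).2
  · refine ⟨(e k).symm ⟨y, hy⟩, ((e k).symm ⟨y, hy⟩).2, ?_⟩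
    change E _ = _
    rw [hE, LinearEquiv.apply_symm_apply]

theorem exists_gradedEquiv_of_finrank_eq {κ : Type*} [DecidableEq κ] {ℳ : κ → Submodule K M}
    {𝒩 : κ → Submodule K N} (hM : DirectSum.IsInternal ℳ) (hN : DirectSum.IsInternal 𝒩)
    (hfM : ∀ k, Module.Finite K (ℳ k)) (hfN : ∀ k, Module.Finite K (𝒩 k))
    (h : ∀ k, Module.finrank K (ℳ k) = Module.finrank K (𝒩 k)) :
    ∃ E : M ≃ₗ[K] N, ∀ k, (ℳ k).map E.toLinearMap = 𝒩 k :=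
  exists_gradedEquiv hM hN fun k => LinearEquiv.ofFinrankEq _ _ (h k)

end Graded

/-! ### Gradings and Hilbert series of retracts and monomial ideals -/

variable {K : Type*} [Field K] {n : ℕ}

/-- The projection of a polynomial to its component of degree `k ∈ ℤ`. -/
def polyComponent (K : Type*) [Field K] (n : ℕ) :
    ℤ → MvPolynomial (Fin n) K →ₗ[K] MvPolynomial (Fin n) K
  | Int.ofNat m => homogeneousComponent m
  | Int.negSucc _ => 0

theorem polyComponent_of_mem {j k : ℤ} {f : MvPolynomial (Fin n) K} (hf : f ∈ polyPart K n j) :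
    polyComponent K n k f = if j = k then f else 0 := by
  cases j with
  | ofNat j =>
    cases k with
    | ofNat k =>
      simp only [Int.ofNat_eq_natCast, Nat.cast_inj]
      exact (homogeneousComponent_of_mem hf).trans (by simp only [eq_comm])
    | negSucc k => simp [polyComponent]
  | negSucc j =>
    have : f = 0 := hf
    simp [this]

/-- A subspace closed under taking homogeneous components inherits the grading. It serves retracts
with any shift s and monomial ideals with s = 0. -/
theorem isInternal_comap_polyPart {M : Type*} [AddCommGroup M] [Module K M]
    (ι : M →ₗ[K] MvPolynomial (Fin n) K) (hι : Function.Injective ι)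
    (h : ∀ x i, homogeneousComponent i (ι x) ∈ LinearMap.range ι) (s : ℤ) :
    DirectSum.IsInternal fun k => (polyPart K n (k - s)).comap ι := by
  rw [DirectSum.isInternal_submodule_iff_iSupIndep_and_iSup_eq_top]
  constructor
  · intro k
    rw [Submodule.disjoint_def]
    intro x hx hx'
    have hle : (⨆ j, ⨆ (_ : j ≠ k), (polyPart K n (j - s)).comap ι) ≤
        LinearMap.ker (polyComponent K n (k - s) ∘ₗ ι) := by
      refine iSup₂_le fun j hj y hy => ?_
      rw [LinearMap.mem_ker, LinearMap.comp_apply, polyComponent_of_mem hy,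
        if_neg (by omega)]
    have h0 := hle hx'
    rw [LinearMap.mem_ker, LinearMap.comp_apply, polyComponent_of_mem hx, if_pos rfl] at h0
    exact hι (h0.trans (map_zero ι).symm)
  · rw [eq_top_iff]
    intro x _
    choose y hy using h x
    have hx : x = ∑ i ∈ Finset.range ((ι x).totalDegree + 1), y i := by
      apply hι
      rw [map_sum, Finset.sum_congr rfl fun i _ => hy i, sum_homogeneousComponent]
    rw [hx]
    refine Submodule.sum_mem _ fun i _ => Submodule.mem_iSup_of_mem ((i : ℤ) + s) ?_
    rw [Submodule.mem_comap, hy, add_sub_cancel_right]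
    exact homogeneousComponent_isHomogeneous i (ι x)

theorem GradedRetract.homogeneousComponent_proj (S : GradedRetract K n) (i : ℕ)
    (f : MvPolynomial (Fin n) K) :
    homogeneousComponent i (S.proj f) = S.proj (homogeneousComponent i f) := by
  conv_lhs => rw [← sum_homogeneousComponent f, map_sum, map_sum]
  rw [Finset.sum_congr rfl fun j _ => homogeneousComponent_of_mem
    (S.proj_mem j _ (homogeneousComponent_mem j f)), Finset.sum_ite_eq]
  split_ifs with h
  · rfl
  · rw [homogeneousComponent_eq_zero _ _ (by simpa using h), map_zero]

theorem GradedRetract.isInternal_shiftedPart (S : GradedRetract K n) (s : ℤ) :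
    DirectSum.IsInternal (S.shiftedPart s) := by
  refine isInternal_comap_polyPart S.algebra.val.toLinearMap Subtype.val_injective ?_ s
  rintro ⟨_, f, rfl⟩ i
  exact ⟨⟨S.proj (homogeneousComponent i f), ⟨_, rfl⟩⟩, (S.homogeneousComponent_proj i f).symm⟩

/-- The ideal `I` is spanned by the monomials with exponents in `E`. -/
def IsMonomialSpan (I : Ideal (MvPolynomial (Fin n) K)) (E : Set (Fin n →₀ ℕ)) : Prop :=
  ∀ f, f ∈ I ↔ ∀ m ∈ f.support, m ∈ E

theorem IsMonomialSpan.isInternal {I : Ideal (MvPolynomial (Fin n) K)} {E : Set (Fin n →₀ ℕ)}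
    (h : IsMonomialSpan I E) : DirectSum.IsInternal (idealPart I) := by
  have := isInternal_comap_polyPart (I.subtype.restrictScalars K) Subtype.val_injective
    (fun x i => ⟨⟨homogeneousComponent i x, (h _).2 fun m hm => (h _).1 x.2 m ?_⟩, rfl⟩) 0
  · simp only [sub_zero] at this
    exact this
  · rw [mem_support_iff, coeff_homogeneousComponent] at hm
    exact mem_support_iff.2 fun h0 => hm (by simp [h0])

theorem idealPart_finite (I : Ideal (MvPolynomial (Fin n) K)) (k : ℤ) :
    Module.Finite K (idealPart I k) := by
  have := (polyPart_finrank K n k).1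
  let ψ : idealPart I k →ₗ[K] polyPart K n k :=
    (I.subtype.restrictScalars K).restrict fun _ hx => hx
  exact Module.Finite.of_injective ψ fun x y hxy =>
    Subtype.ext (Subtype.ext (congrArg (fun z : polyPart K n k => (z : MvPolynomial (Fin n) K)) hxy))

theorem idealPart_finrank_of_neg (I : Ideal (MvPolynomial (Fin n) K)) {k : ℤ} (hk : k < 0) :
    Module.finrank K (idealPart I k) = 0 := by
  obtain ⟨j, rfl⟩ := Int.eq_negSucc_of_lt_zero hk
  have : idealPart I (Int.negSucc j) = ⊥ := by
    rw [eq_bot_iff]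
    intro x hx
    exact Subtype.ext hx
  rw [this, finrank_bot]

/-- The power series `f` is the Hilbert series of the ideal `I`. -/
def IsHilbertSeries (I : Ideal (MvPolynomial (Fin n) K)) (f : PowerSeries ℤ) : Prop :=
  ∀ k : ℕ, PowerSeries.coeff k f = (Module.finrank K (idealPart I k) : ℤ)

theorem IsMonomialSpan.isHilbertSeries {I : Ideal (MvPolynomial (Fin n) K)}
    {E : Set (Fin n →₀ ℕ)} (h : IsMonomialSpan I E) {f : PowerSeries ℤ}
    (s : ℕ → Finset (Fin n → ℕ)) (hs : ∀ k (m : Fin n →₀ ℕ), ⇑m ∈ s k ↔ m.degree = k ∧ m ∈ E)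
    (hf : ∀ k, PowerSeries.coeff k f = ((s k).card : ℤ)) : IsHilbertSeries I f := by
  intro k
  rw [hf, ← (finrank_restrictSupport K {m | m.degree = k ∧ m ∈ E} (s k)
    fun m => (hs k m).symm).2, Nat.cast_inj]
  refine LinearEquiv.finrank_eq (LinearEquiv.symm ?_)
  refine (Submodule.equivMapOfInjective (I.subtype.restrictScalars K)
    Subtype.val_injective _).trans (LinearEquiv.ofEq _ _ ?_)
  have hhom : ∀ g : MvPolynomial (Fin n) K,
      g ∈ polyPart K n k ↔ ∀ m ∈ g.support, m.degree = k := by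
    intro g
    change g ∈ homogeneousSubmodule (Fin n) K k ↔ _
    rw [homogeneousSubmodule_eq_finsupp_supported]
    rfl
  ext g
  rw [mem_restrictSupport]
  constructor
  · rintro ⟨x, hx, rfl⟩ m hm
    exact ⟨(hhom _).1 hx m hm, (h _).1 x.2 m hm⟩
  · intro hg
    exact ⟨⟨g, (h g).2 fun m hm => (hg m hm).2⟩, (hhom g).2 fun m hm => (hg m hm).1, rfl⟩

/-! ### Hilbert decompositions and Hilbert series -/

/-- Each term t^s/(1-t)^r is realised by a coordinate retract, which is where r ≤ n is used;
equality of dimensions degree by degree then gives the isomorphism. -/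
theorem exists_hilbertDecomposition {I : Ideal (MvPolynomial (Fin n) K)}
    (hI : DirectSum.IsInternal (idealPart I)) {f : PowerSeries ℤ} (hf : IsHilbertSeries I f)
    {p : ℕ} (hp : f ∈ decomposable p n) :
    ∃ H : HilbertDecomposition n (idealPart I), (p : ℕ∞) ≤ H.hdepth := by
  obtain ⟨l, hl, rfl⟩ := AddSubmonoid.exists_list_of_mem_closure hp
  choose r s hpr hrn hrs using fun i : Fin l.length => hl (l.get i) (l.get_mem i)
  have hsum : l.sum = ∑ i, PowerSeries.X ^ s i * geomSeries ^ r i := by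
    rw [← Finset.sum_congr rfl fun i _ => hrs i, ← List.sum_ofFn, List.ofFn_get]
  obtain ⟨S, hS⟩ : ∃ S : Fin l.length → GradedRetract K n, ∀ i, (S i).HasRank (r i) :=
    ⟨_, fun i => GradedRetract.coordinate_hasRank (hrn i)⟩
  have hdim := fun k : ℤ => finrank_pi_submodule (fun i => (S i).shiftedPart (s i) k)
    (fun i => ((hS i).shiftedPart_eq _ _).1)
  have heq : ∀ k : ℤ, Module.finrank K (idealPart I k) =
      Module.finrank K (Submodule.pi Set.univ fun i => (S i).shiftedPart (s i) k) := by
    intro k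
    rw [(hdim k).2, Finset.sum_congr rfl fun i _ => ((hS i).shiftedPart_eq (s i) k).2]
    rcases lt_or_ge k 0 with hk | hk
    · rw [idealPart_finrank_of_neg I hk]
      exact (Finset.sum_eq_zero fun i _ => polyHilbert_of_neg _ (by omega)).symm
    · lift k to ℕ using hk
      have := hf k
      rw [hsum, map_sum,
        Finset.sum_congr rfl fun i _ => coeff_X_pow_mul_geomSeries_pow _ _ _] at this
      exact_mod_cast this.symm
  obtain ⟨E, hE⟩ := exists_gradedEquiv_of_finrank_eq hI
    (isInternal_pi (fun i => (S i).shiftedPart (s i)) fun i => (S i).isInternal_shiftedPart (s i))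
    (idealPart_finite I) (fun k => (hdim k).1) heq
  refine ⟨⟨l.length, S, fun i => s i, E, hE⟩, ?_⟩
  refine le_iInf fun i => ?_
  rw [(hS i).depth_eq]
  exact_mod_cast hpr i

theorem mem_decomposable_of_le_hdepth {I : Ideal (MvPolynomial (Fin n) K)} {f : PowerSeries ℤ}
    (hf : IsHilbertSeries I f) (H : HilbertDecomposition n (idealPart I)) {q : ℕ}
    (hq : (q : ℕ∞) ≤ H.hdepth) : f ∈ decomposable q n := by
  choose r hrn hrank using fun i => (H.retract i).exists_hasRank
  have hqr : ∀ i, q ≤ r i := by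
    intro i
    have := hq.trans (iInf_le _ i)
    rw [(hrank i).depth_eq] at this
    exact_mod_cast this
  have hdim : ∀ k, Module.finrank K (idealPart I k) = ∑ i, polyHilbert (r i) (k - H.shift i) := by
    intro k
    rw [← Finset.sum_congr rfl fun i _ => ((hrank i).shiftedPart_eq (H.shift i) k).2,
      ← (finrank_pi_submodule _ fun i => ((hrank i).shiftedPart_eq (H.shift i) k).1).2,
      ← H.map_iso, LinearEquiv.finrank_map_eq]
  -- A summand with negative shift would be nonzero in a negative degree, where the ideal vanishes.
  have hshift : ∀ i, 0 ≤ H.shift i := by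
    intro i
    by_contra hi
    have h0 := hdim (H.shift i)
    rw [idealPart_finrank_of_neg I (not_le.1 hi), eq_comm, Finset.sum_eq_zero_iff] at h0
    have := h0 i (Finset.mem_univ i)
    rw [sub_self] at this
    exact polyHilbert_zero _ this
  have hfsum : f = ∑ i, PowerSeries.X ^ (H.shift i).toNat * geomSeries ^ r i := by
    ext k
    rw [hf, hdim, map_sum, Nat.cast_sum]
    refine Finset.sum_congr rfl fun i _ => ?_
    rw [coeff_X_pow_mul_geomSeries_pow, Int.toNat_of_nonneg (hshift i)]
  rw [hfsum]
  exact sum_mem fun i _ => X_pow_mul_geomSeries_pow_mem _ (hqr i) (hrn i)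

theorem decomposable_eq_bot {p n : ℕ} (h : n < p) : decomposable p n = ⊥ := by
  rw [decomposable, eq_bot_iff, AddSubmonoid.closure_le]
  rintro f ⟨r, s, h1, h2, -⟩
  omega

/-- The bound n needs f ≠ 0: the zero ideal has the empty decomposition, whose depth is ⊤. A finite
supremum of a nonempty set in `ℕ∞` is attained. -/
theorem hdepth_spec {I : Ideal (MvPolynomial (Fin n) K)}
    (hI : DirectSum.IsInternal (idealPart I)) {f : PowerSeries ℤ} (hf : IsHilbertSeries I f)
    (hne : f ≠ 0) {p : ℕ} (hp : f ∈ decomposable p n) :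
    IsGreatest (hdepthSet n (idealPart I)) (hdepth I) ∧
      ∃ a : ℕ, hdepth I = a ∧ ∀ q : ℕ, q ≤ a ↔ f ∈ decomposable q n := by
  have hlt : sSup (hdepthSet n (idealPart I)) < ⊤ := by
    refine lt_of_le_of_lt (b := (n : ℕ∞)) (sSup_le ?_) (ENat.natCast_lt_top n)
    rintro _ ⟨H, rfl⟩
    by_contra hH
    have h1 : ((n + 1 : ℕ) : ℕ∞) ≤ H.hdepth := by
      rw [Nat.cast_add, Nat.cast_one]
      exact Order.add_one_le_of_lt (not_le.1 hH)
    have := mem_decomposable_of_le_hdepth hf H h1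
    rw [decomposable_eq_bot (Nat.lt_succ_self n)] at this
    exact hne this
  obtain ⟨H, -⟩ := exists_hilbertDecomposition hI hf hp
  have : Nonempty (hdepthSet n (idealPart I)) := ⟨⟨_, H, rfl⟩⟩
  have hmem : hdepth I ∈ hdepthSet n (idealPart I) := ENat.sSup_mem_of_nonempty_of_lt_top hlt
  have htop : hdepth I ≠ ⊤ := ne_of_lt hlt
  refine ⟨⟨hmem, fun x hx => le_sSup hx⟩, (hdepth I).toNat,
    (ENat.natCast_toNat htop).symm, fun q => ?_⟩
  rw [← Nat.cast_le (α := ℕ∞), ENat.natCast_toNat htop]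
  constructor
  · intro hq
    obtain ⟨H', hH'⟩ := hmem
    rw [← hH'] at hq
    exact mem_decomposable_of_le_hdepth hf H' hq
  · intro hq
    obtain ⟨H', hH'⟩ := exists_hilbertDecomposition hI hf hq
    exact hH'.trans (le_sSup ⟨H', rfl⟩)

/-! ### The two ideals -/

theorem isMonomialSpan_pow_idealOfVars (K : Type*) [Field K] (N d : ℕ) :
    IsMonomialSpan (idealOfVars (Fin N) K ^ d) {m | d ≤ m.degree} :=
  fun f => mem_pow_idealOfVars_iff d f

theorem isHilbertSeries_pow_idealOfVars (K : Type*) [Field K] (N d : ℕ) :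
    IsHilbertSeries (idealOfVars (Fin N) K ^ d) (tailSeries N d) := by
  refine (isMonomialSpan_pow_idealOfVars K N d).isHilbertSeries
    (fun k => if d ≤ k then exponents N 0 k else ∅) (fun k m => ?_) fun k => ?_
  · rw [Set.mem_ofPred_eq]
    split_ifs with h
    · rw [mem_exponents, Finsupp.degree_eq_sum]
      simp only [zero_le, and_true]
      exact ⟨fun e => ⟨e, e ▸ h⟩, fun e => e.1⟩
    · simp only [Finset.notMem_empty, false_iff]
      rintro ⟨rfl, h'⟩
      exact h h'
  · rw [coeff_tailSeries, ← supportSeries_zero, supportSeries, PowerSeries.coeff_mk]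
    split_ifs <;> simp

theorem isMonomialSpan_squarefreeVeronese (K : Type*) [Field K] (n d : ℕ) :
    IsMonomialSpan (squarefreeVeronese K n d)
      {m | d ≤ (Finset.univ.filter fun i => m i ≠ 0).card} := by
  intro f
  have hspan : squarefreeVeronese K n d = Ideal.span ((fun m => monomial m (1 : K)) ''
      {m | ∃ s : Finset (Fin n), s.card = d ∧ m = ∑ i ∈ s, Finsupp.single i 1}) := by
    rw [squarefreeVeronese]
    congr 1
    ext g
    constructor
    · rintro ⟨s, hs, rfl⟩
      exact ⟨_, ⟨s, hs, rfl⟩, monomial_sum_one s _⟩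
    · rintro ⟨_, ⟨s, hs, rfl⟩, rfl⟩
      exact ⟨s, hs, monomial_sum_one s _⟩
  -- A squarefree monomial divides another monomial exactly when its variables lie in the support of
  -- the latter.
  have hle : ∀ (s : Finset (Fin n)) (m : Fin n →₀ ℕ),
      ∑ i ∈ s, Finsupp.single i 1 ≤ m ↔ s ⊆ Finset.univ.filter fun i => m i ≠ 0 := by
    intro s m
    have hval : ∀ j, (∑ i ∈ s, Finsupp.single i 1 : Fin n →₀ ℕ) j = if j ∈ s then 1 else 0 := by
      intro j
      simp [Finsupp.finsetSum_apply, Finsupp.single_apply]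
    rw [Finsupp.le_def]
    simp only [hval, Finset.subset_iff, Finset.mem_filter, Finset.mem_univ, true_and]
    refine forall_congr' fun j => ?_
    by_cases hj : j ∈ s <;> simp [hj, Nat.one_le_iff_ne_zero]
  rw [hspan, mem_ideal_span_monomial_image]
  refine forall₂_congr fun m _ => ?_
  constructor
  · rintro ⟨_, ⟨s, rfl, rfl⟩, h⟩
    exact Finset.card_le_card ((hle s m).1 h)
  · intro h
    obtain ⟨s, hs, hcard⟩ := Finset.exists_subset_card_eq h
    exact ⟨_, ⟨s, hcard, rfl⟩, (hle s m).2 hs⟩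

theorem isHilbertSeries_squarefreeVeronese (K : Type*) [Field K] (n d : ℕ) :
    IsHilbertSeries (squarefreeVeronese K n d) (supportSeries n d) := by
  refine (isMonomialSpan_squarefreeVeronese K n d).isHilbertSeries (exponents n d)
    (fun k m => ?_) fun k => PowerSeries.coeff_mk _ _
  rw [mem_exponents, Finsupp.degree_eq_sum]
  rfl

theorem tailSeries_succ_ne_zero (N d : ℕ) : tailSeries (N + 1) d ≠ 0 := by
  intro h
  have h0 := congrArg (PowerSeries.coeff d) h
  rw [coeff_tailSeries, if_pos le_rfl, ← supportSeries_zero, supportSeries, PowerSeries.coeff_mk,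
    map_zero, Nat.cast_eq_zero, Finset.card_eq_zero] at h0
  have : Pi.single 0 d ∈ exponents (N + 1) 0 d := mem_exponents.2 ⟨by simp, Nat.zero_le _⟩
  simp [h0] at this

end HilbertDepth

end

/-! ### Comparison of the two Hilbert depths -/

theorem theorem1p4 (K : Type*) [Field K] (n d : ℕ) (hd : 1 ≤ d) (hdn : d ≤ n) :
    -- both maxima exist
    IsGreatest
        (HilbertDepth.hdepthSet (n - d + 1)
          (HilbertDepth.idealPart (MvPolynomial.idealOfVars (Fin (n - d + 1)) K ^ d)))
        (HilbertDepth.hdepth (MvPolynomial.idealOfVars (Fin (n - d + 1)) K ^ d)) ∧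
      IsGreatest
        (HilbertDepth.hdepthSet n
          (HilbertDepth.idealPart (HilbertDepth.squarefreeVeronese K n d)))
        (HilbertDepth.hdepth (HilbertDepth.squarefreeVeronese K n d)) ∧
      HilbertDepth.hdepth (MvPolynomial.idealOfVars (Fin (n - d + 1)) K ^ d) +
          ((d - 1 : ℕ) : ℕ∞) =
        HilbertDepth.hdepth (HilbertDepth.squarefreeVeronese K n d) := by
  open HilbertDepth in
  have hseries := supportSeries_eq hd hdn
  have htail_ne := tailSeries_succ_ne_zero (n - d) d
  have hmul : (1 - PowerSeries.X) ^ (d - 1) * supportSeries n d = tailSeries (n - d + 1) d := by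
    rw [hseries]
    linear_combination
      tailSeries (n - d + 1) d * one_sub_pow_mul_geomSeries_pow (d - 1)
  have hsupp_ne : supportSeries n d ≠ 0 := fun h => htail_ne (by rw [← hmul, h, mul_zero])
  have hup : ∀ q, tailSeries (n - d + 1) d ∈ decomposable q (n - d + 1) →
      supportSeries n d ∈ decomposable (q + (d - 1)) n := by
    intro q hq
    have := mul_geomSeries_pow_mem (d - 1) hq
    rwa [← hseries, show n - d + 1 + (d - 1) = n by omega] at this
  obtain ⟨hg1, a, ha, hspec1⟩ := hdepth_spec (isMonomialSpan_pow_idealOfVars K _ d).isInternal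
    (isHilbertSeries_pow_idealOfVars K (n - d + 1) d) htail_ne (tailSeries_mem_decomposable _ _)
  obtain ⟨hg2, b, hb, hspec2⟩ := hdepth_spec (isMonomialSpan_squarefreeVeronese K n d).isInternal
    (isHilbertSeries_squarefreeVeronese K n d) hsupp_ne (hup 0 (tailSeries_mem_decomposable _ _))
  refine ⟨hg1, hg2, ?_⟩
  rw [ha, hb, ← Nat.cast_add, Nat.cast_inj]
  refine le_antisymm ((hspec2 _).2 (hup a ((hspec1 a).1 le_rfl))) ?_
  -- If b ≤ d - 1 the remaining inequality is trivial; otherwise b = (d - 1) + c and it suffices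
  -- that c ≤ a.
  rcases le_total b (d - 1) with hlt | hle
  · omega
  · obtain ⟨c, rfl⟩ := Nat.exists_eq_add_of_le hle
    have hmem := (hspec2 _).1 le_rfl
    have hcn : c ≤ n - d + 1 := by
      by_contra hc
      rw [decomposable_eq_bot (by omega)] at hmem
      exact hsupp_ne hmem
    have hnonneg := coeff_nonneg_of_mem_decomposable hmem
    -- The factor (1-t)^(d-1) turns the series of the Veronese ideal into that of the power of the
    -- maximal ideal, leaving (1-t)^c for the positivity criterion.
    rw [pow_add, mul_comm (_ ^ (d - 1)), mul_assoc, hmul] at hnonneg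
    have := (hspec1 c).2 (tailSeries_mem_decomposable_of_coeff_nonneg hcn hnonneg)
    omega
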